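/- \textbf{Theorem (Van Kampen's theorem).} Let $X$ be a topological space, let $(X_j)_{j\in J}$ be a family of open, path-connected subspaces with $X=\bigcup_{j\in J}X_j$, and let $x_0\in\bigcap_{j\in J}X_j$. Let $\iota_j\colon \pi_1(X_j,x_0)\to\pi_1(X,x_0)$ be the homomorphism induced by the inclusion $X_j\subseteq X$, let $\coprod_{j\in J}\pi_1(X_j,x_0)$ be the free product of the groups $\pi_1(X_j,x_0)$, with canonical homomorphisms $\varphi_j\colon\pi_1(X_j,x_0)\to\coprod_{j\in J}\pi_1(X_j,x_0)$, and let $$\Phi\colon \coprod_{j\in J}\pi_1(X_j,x_0)\to\pi_1(X,x_0)$$ be the unique homomorphism with $\Phi\circ\varphi_j=\iota_j$ for all $j\in J$. For $i,j\in J$ let $\iota_{ij}\colon\pi_1(X_i\cap X_j,x_0)\to\pi_1(X_i,x_0)$ and $\iota_{ji}\colon\pi_1(X_i\cap X_j,x_0)\to\pi_1(X_j,x_0)$ be the homomorphisms induced by the inclusions, and let $N$ be the smallest normal subgroup of $\coprod_{j\in J}\pi_1(X_j,x_0)$ containing all elements $\varphi_i(\iota_{ij}(g))\,\varphi_j(\iota_{ji}(g))^{-1}$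 with $i,j\in J$ and $g\in\pi_1(X_i\cap X_j,x_0)$. \begin{enumerate} \item If $X_i\cap X_j$ is path connected for all $i,j\in J$, then $\Phi$ is surjective. \item If $X_i\cap X_j\cap X_k$ is path connected for all $i,j,k\in J$ (not necessarily distinct), then $\ker\Phi=N$. \end{enumerate} -/

import Mathlib

namespace VanKampen

/-- The homomorphism `π₁(A, x₀) → π₁(X, x₀)` induced by the inclusion of a subspace `A` of `X`. -/
noncomputable def inclHom {X : Type*} [TopologicalSpace X] (A : Set X) (x₀ : X) (hx : x₀ ∈ A) :
    FundamentalGroup A ⟨x₀, hx⟩ →* FundamentalGroup X x₀ :=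
  FundamentalGroup.map (⟨Subtype.val, continuous_subtype_val⟩ : C(A, X)) ⟨x₀, hx⟩

/-- The homomorphism `π₁(A, x₀) → π₁(B, x₀)` induced by the inclusion of subspaces `A ⊆ B`. -/
noncomputable def inclHomOfSubset {X : Type*} [TopologicalSpace X] {A B : Set X} (h : A ⊆ B)
    (x₀ : X) (hx : x₀ ∈ A) :
    FundamentalGroup A ⟨x₀, hx⟩ →* FundamentalGroup B ⟨x₀, h hx⟩ :=
  FundamentalGroup.map (⟨Set.inclusion h, continuous_inclusion h⟩ : C(A, B)) ⟨x₀, hx⟩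

/-- The free product (coproduct of groups) of the fundamental groups `π₁(U j, x₀)`. -/
abbrev FreeProd {X J : Type*} [TopologicalSpace X] (U : J → Set X) (x₀ : X)
    (hx : ∀ j, x₀ ∈ U j) : Type _ :=
  Monoid.CoprodI (fun j => FundamentalGroup (U j) ⟨x₀, hx j⟩)

/-- The canonical homomorphism from `π₁(U j, x₀)` to the free product. -/
noncomputable def toFreeProd {X J : Type*} [TopologicalSpace X] (U : J → Set X) (x₀ : X)
    (hx : ∀ j, x₀ ∈ U j) (j : J) :
    FundamentalGroup (U j) ⟨x₀, hx j⟩ →* FreeProd U x₀ hx :=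
  Monoid.CoprodI.of (M := fun j => FundamentalGroup (U j) ⟨x₀, hx j⟩) (i := j)

/-- The homomorphism `Φ` from the free product to `π₁(X, x₀)` which restricts on each factor
`π₁(U j, x₀)` to the homomorphism induced by the inclusion. -/
noncomputable def Phi {X J : Type*} [TopologicalSpace X] (U : J → Set X) (x₀ : X)
    (hx : ∀ j, x₀ ∈ U j) : FreeProd U x₀ hx →* FundamentalGroup X x₀ :=
  Monoid.CoprodI.lift (fun j => inclHom (U j) x₀ (hx j))

/-- The smallest normal subgroup of the free product that contains `ι_{ij}(g) ι_{ji}(g)⁻¹` for all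
`i`, `j` and all `g` in `π₁(U i ∩ U j, x₀)`. -/
noncomputable def N {X J : Type*} [TopologicalSpace X] (U : J → Set X) (x₀ : X)
    (hx : ∀ j, x₀ ∈ U j) : Subgroup (FreeProd U x₀ hx) :=
  Subgroup.normalClosure
    {w | ∃ (i j : J) (g : FundamentalGroup ↑(U i ∩ U j) ⟨x₀, hx i, hx j⟩),
      w = toFreeProd U x₀ hx i
            (inclHomOfSubset (Set.inter_subset_left : U i ∩ U j ⊆ U i) x₀ ⟨hx i, hx j⟩ g) *
          (toFreeProd U x₀ hx j
            (inclHomOfSubset (Set.inter_subset_right : U i ∩ U j ⊆ U j) x₀ ⟨hx i, hx j⟩ g))⁻¹}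

end VanKampen

/-!
Let `f j : π₁(U j, x₀) → G` be homomorphisms that agree on the loops in the intersections
`U i ∩ U j`. If the triple intersections are path connected, then `f` extends to the paths from
`x₀` that stay in one `U j`, and the quotients of the values of this extension give a parallel
transport, with values in `G`, along the paths that stay in one `U j`. A potential along a path
`γ` is a function on `[0, 1]` that changes over every short piece of `γ` by the transport along
it. Subdivision shows that a potential exists and that its total increment is unique, so the
transport extends to all paths. It is invariant under homotopies, since these can be cut into
squares that lie in one `U j`. Hence there is a homomorphism `π₁(X, x₀) → G` that restricts to
every `f j`, and for `G = FreeProd / N` this forces `ker Φ ≤ N`. For the surjectivity of `Φ`,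
subdivide a loop into paths that lie in one `U j`, and connect the points of division to `x₀`
within the intersections.
-/

open CategoryTheory Set unitInterval
open scoped Topology

namespace VanKampen

section UnitInterval

theorem unitInterval_induction {P : I → I → Prop}
    (short : ∀ x, ∃ S ∈ 𝓝 x, ∀ a b, a ≤ b → Icc a b ⊆ S → P a b)
    (trans : ∀ a b c, a ≤ b → b ≤ c → P a b → P b c → P a c) : P 0 1 := by
  choose S hS hP using short
  obtain ⟨d, d_zero, d_mono, ⟨n, hn⟩, hd⟩ := exists_monotone_Icc_subset_open_cover_unitInterval
    (c := fun x => interior (S x)) (fun _ => isOpen_interior)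
    fun x _ => mem_iUnion.2 ⟨x, mem_interior_iff_mem_nhds.2 (hS x)⟩
  have consecutive (k : ℕ) : P (d k) (d (k + 1)) := by
    obtain ⟨x, hx⟩ := hd k
    exact hP x _ _ (d_mono k.le_succ) (hx.trans interior_subset)
  have initial (k : ℕ) : P (d 0) (d (k + 1)) := by
    induction k with
    | zero => exact consecutive 0
    | succ k ih =>
      exact trans _ _ _ (d_mono (k + 1).zero_le) (d_mono (k + 1).le_succ) ih (consecutive _)
  simpa [d_zero, hn (n + 1) n.le_succ] using initial n

theorem convexComb_le_convexComb {a b s t : I} (hab : a ≤ b) (hst : s ≤ t) :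
    Icc.convexComb a b s ≤ Icc.convexComb a b t := by
  rw [← Subtype.coe_le_coe] at *
  simp only [Icc.coe_convexComb]
  nlinarith

theorem exists_convexComb_eq {a b t : I} (ha : a ≤ t) (hb : t ≤ b) :
    ∃ r, Icc.convexComb a b r = t := by
  have ht : t ∈ uIcc a b := mem_uIcc.2 (.inl ⟨ha, hb⟩)
  rwa [← Path.range_subpathAux] at ht

variable {X : Type*} [TopologicalSpace X] {x y z : X}

theorem subpath_apply (γ : Path x y) (s t r : I) :
    γ.subpath s t r = γ (Icc.convexComb s t r) :=
  rfl

theorem range_subpath_subset (γ : Path x y) {a s t c : I} (has : a ≤ s) (hst : s ≤ t)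
    (htc : t ≤ c) : range (γ.subpath s t) ⊆ range (γ.subpath a c) := by
  rw [γ.range_subpath_of_le s t hst, γ.range_subpath_of_le a c (has.trans (hst.trans htc))]
  exact image_mono (Icc_subset_Icc has htc)

theorem exists_mem_nhds_range_subpath_subset {J : Type*} {U : J → Set X}
    (hU : ∀ x, ∃ j, U j ∈ 𝓝 x) (γ : Path x y) (t : I) :
    ∃ S ∈ 𝓝 t, ∃ j, ∀ a b, a ≤ b → Icc a b ⊆ S → range (γ.subpath a b) ⊆ U j := by
  obtain ⟨j, hj⟩ := hU (γ t)
  refine ⟨γ ⁻¹' U j, γ.continuous.continuousAt hj, j, fun a b hab hS => ?_⟩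
  rw [γ.range_subpath_of_le a b hab]
  exact image_subset_iff.2 hS

theorem subpath_subpath_apply (γ : Path x y) (a b s t r : I) :
    (γ.subpath a b).subpath s t r =
      γ.subpath (Icc.convexComb a b s) (Icc.convexComb a b t) r := by
  refine congrArg γ (Subtype.ext ?_)
  simp only [Icc.coe_convexComb]
  ring

theorem exists_subpath_trans_apply_eq (p : Path x y) (q : Path y z) :
    ∃ a, (∀ r, (p.trans q).subpath 0 a r = p r) ∧ ∀ r, (p.trans q).subpath a 1 r = q r := by
  let half : I := ⟨1 / 2, by norm_num, by norm_num⟩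
  have left_half (r : I) : (Icc.convexComb 0 half r : ℝ) = r / 2 := by
    simp [Icc.coe_convexComb, half, div_eq_mul_inv]
  have right_half (r : I) : (Icc.convexComb half 1 r : ℝ) = (1 + r) / 2 := by
    simp [Icc.coe_convexComb, half]
    ring
  refine ⟨half, fun r => ?_, fun r => ?_⟩
  · rw [subpath_apply, Path.trans_apply, dif_pos (by rw [left_half]; linarith [r.2.2])]
    congr 1
    ext
    simp only [left_half]
    ring
  · rcases eq_or_lt_of_le (nonneg' (t := r)) with rfl | hr
    · rw [subpath_apply, Icc.convexComb_zero, q.source]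
      simp [Path.trans_apply, half]
    · have hr : 0 < (r : ℝ) := hr
      rw [subpath_apply, Path.trans_apply, dif_neg (by rw [right_half]; linarith)]
      congr 1
      ext
      simp only [right_half]
      ring

end UnitInterval

section LoopDiff

variable {C D : Type*} [Groupoid C] [Groupoid D] {a b c d : C}

/-- The loop that runs along `p` and returns along `q`. -/
def loopDiff (p q : a ⟶ b) : End a :=
  p ≫ Groupoid.inv q

-- Multiplication in `End a` is composition in the opposite order.
theorem loopDiff_mul_loopDiff (p q r : a ⟶ b) :
    loopDiff q r * loopDiff p q = loopDiff p r := by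
  simp [loopDiff, End.mul_def]

theorem loopDiff_comp_comp (p q : a ⟶ b) (w : b ⟶ c) :
    loopDiff (p ≫ w) (q ≫ w) = loopDiff p q := by
  simp [loopDiff]

theorem loopDiff_id (p : End a) : loopDiff p (𝟙 a) = p := by
  simp [loopDiff]

theorem map_loopDiff (F : C ⥤ D) (p q : a ⟶ b) :
    F.mapEnd a (loopDiff p q) = loopDiff (F.map p) (F.map q) := by
  simp [loopDiff, Functor.mapEnd, Functor.map_inv]

end LoopDiff

section Subspace

variable {X : Type*} [TopologicalSpace X] {A B D : Set X} {x y z : X}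

/-- Homotopy classes of paths from `x` to `y` in the subspace `A`. -/
abbrev HomIn (A : Set X) {x y : X} (hx : x ∈ A) (hy : y ∈ A) :=
  FundamentalGroupoid.mk (⟨x, hx⟩ : A) ⟶ FundamentalGroupoid.mk (⟨y, hy⟩ : A)

/-- A path that lies in a subset, as a path in the subspace. -/
def restrictPath {A : Set X} (γ : Path x y) (h : ∀ t, γ t ∈ A) :
    Path (⟨x, γ.source ▸ h 0⟩ : A) ⟨y, γ.target ▸ h 1⟩ where
  toFun t := ⟨γ t, h t⟩
  continuous_toFun := by fun_prop
  source' := by simp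
  target' := by simp

theorem nonempty_homIn (hA : IsPathConnected A) (hx : x ∈ A) (hy : y ∈ A) :
    Nonempty (HomIn A hx hy) := by
  have := isPathConnected_iff_pathConnectedSpace.1 hA
  exact ⟨.mk (PathConnectedSpace.somePath _ _)⟩

variable {hx : x ∈ A} {hy : y ∈ A} {hz : z ∈ A}

/-- The map on path classes induced by the inclusion of a subspace in a larger one. -/
noncomputable def inclMap (h : A ⊆ B) (p : HomIn A hx hy) :
    HomIn B (mem_of_subset_of_mem h hx) (mem_of_subset_of_mem h hy) :=
  (FundamentalGroupoid.map ⟨inclusion h, continuous_inclusion h⟩).map p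

theorem inclMap_comp (h : A ⊆ B) (p : HomIn A hx hy) (q : HomIn A hy hz) :
    inclMap h (p ≫ q) = inclMap h p ≫ inclMap h q :=
  Functor.map_comp _ p q

theorem inclMap_inclMap (h : A ⊆ B) (h' : B ⊆ D) (p : HomIn A hx hy) :
    inclMap h' (inclMap h p) = inclMap (h.trans h') p := by
  induction p using Path.Homotopic.Quotient.ind
  rfl

theorem inclHomOfSubset_loopDiff (h : A ⊆ B) (p q : HomIn A hx hy) :
    inclHomOfSubset h x hx (loopDiff p q) = loopDiff (inclMap h p) (inclMap h q) :=
  map_loopDiff _ p q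

/-- The map on path classes induced by the inclusion of a subspace in the whole space. -/
noncomputable def valMap (p : HomIn A hx hy) :
    FundamentalGroupoid.mk x ⟶ FundamentalGroupoid.mk y :=
  (FundamentalGroupoid.map ⟨Subtype.val, continuous_subtype_val⟩).map p

theorem valMap_comp (p : HomIn A hx hy) (q : HomIn A hy hz) :
    valMap (p ≫ q) = valMap p ≫ valMap q :=
  Functor.map_comp _ p q

theorem valMap_inclMap (h : A ⊆ B) (p : HomIn A hx hy) : valMap (inclMap h p) = valMap p := by
  induction p using Path.Homotopic.Quotient.ind
  rfl

theorem inclHom_loopDiff (p q : HomIn A hx hy) :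
    inclHom A x hx (loopDiff p q) = loopDiff (valMap p) (valMap q) :=
  map_loopDiff _ p q

end Subspace

section Surjectivity

variable {X J : Type*} [TopologicalSpace X] {U : J → Set X}

theorem morphismProperty_of_local (hU : ∀ x, ∃ j, U j ∈ 𝓝 x)
    (W : MorphismProperty (FundamentalGroupoid X)) [W.IsStableUnderComposition]
    (hW : ∀ j {x y : X} (hx : x ∈ U j) (hy : y ∈ U j) (w : HomIn (U j) hx hy), W (valMap w))
    {x y : FundamentalGroupoid X} (w : x ⟶ y) : W w := by
  obtain ⟨x⟩ := x
  obtain ⟨y⟩ := y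
  induction w using Path.Homotopic.Quotient.ind with | mk γ =>
  have of_subpath {x y : X} (γ : Path x y)
      (h : W (.mk (γ.subpath 0 1) : FundamentalGroupoid.mk (γ 0) ⟶ .mk (γ 1))) :
      W (.mk γ : FundamentalGroupoid.mk x ⟶ .mk y) := by
    obtain ⟨γ, rfl, rfl⟩ := γ
    rwa [Path.subpath_zero_one] at h
  refine of_subpath γ ?_
  refine unitInterval_induction
    (P := fun a b => W (.mk (γ.subpath a b) : FundamentalGroupoid.mk (γ a) ⟶ .mk (γ b)))
    (fun t => ?_) fun a b c _ _ hab hbc => ?_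
  · obtain ⟨S, hS, j, hj⟩ := exists_mem_nhds_range_subpath_subset hU γ t
    refine ⟨S, hS, fun a b hab h => ?_⟩
    have hab := range_subset_iff.1 (hj a b hab h)
    exact hW j _ _ (.mk (restrictPath (γ.subpath a b) hab))
  · have := W.comp_mem _ _ hab hbc
    rwa [← Path.Homotopic.Quotient.eq.2 ⟨Path.Homotopy.subpathTransSubpath γ a b c⟩]

variable {x₀ : X} {hx : ∀ j, x₀ ∈ U j}

theorem inclHom_mem_range_Phi (j : J) (g : FundamentalGroup (U j) ⟨x₀, hx j⟩) :
    inclHom (U j) x₀ (hx j) g ∈ (Phi U x₀ hx).range :=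
  ⟨toFreeProd U x₀ hx j g, Monoid.CoprodI.lift_of _ _⟩

variable (hx) in
/-- The morphisms `w` of the fundamental groupoid such that every loop composed of a path from `x₀`
in some `U i`, of `w`, and of a path back to `x₀` in some `U j` comes from the free product. -/
def comesFromFreeProd : MorphismProperty (FundamentalGroupoid X) := fun x y w =>
  ∀ i j (hi : x.as ∈ U i) (hj : y.as ∈ U j) (p : HomIn (U i) (hx i) hi)
    (q : HomIn (U j) (hx j) hj), loopDiff (valMap p ≫ w) (valMap q) ∈ (Phi U x₀ hx).range

theorem loopDiff_valMap_mem_range_Phi (hconn : ∀ i j, IsPathConnected (U i ∩ U j)) {i j : J}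
    {x : X} {hi : x ∈ U i} {hj : x ∈ U j} (p : HomIn (U i) (hx i) hi)
    (q : HomIn (U j) (hx j) hj) :
    loopDiff (valMap p) (valMap q) ∈ (Phi U x₀ hx).range := by
  obtain ⟨l⟩ := nonempty_homIn (hconn i j) ⟨hx i, hx j⟩ ⟨hi, hj⟩
  rw [← loopDiff_mul_loopDiff _ (valMap l), ← valMap_inclMap inter_subset_left l]
  nth_rw 1 [valMap_inclMap inter_subset_left l]
  rw [← valMap_inclMap inter_subset_right l, ← inclHom_loopDiff, ← inclHom_loopDiff]
  exact mul_mem (inclHom_mem_range_Phi _ _) (inclHom_mem_range_Phi _ _)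

theorem comesFromFreeProd_valMap (hconn : ∀ i j, IsPathConnected (U i ∩ U j)) {k : J} {x y : X}
    {hxk : x ∈ U k} {hyk : y ∈ U k} (w : HomIn (U k) hxk hyk) :
    comesFromFreeProd hx (valMap w) := by
  intro i j hi hj p q
  obtain ⟨l⟩ := nonempty_homIn (hconn i k) ⟨hx i, hx k⟩ ⟨hi, hxk⟩
  let l' : HomIn (U k) (hx k) hxk := inclMap inter_subset_right l
  rw [← loopDiff_mul_loopDiff _ (valMap l' ≫ valMap w), loopDiff_comp_comp, ← valMap_comp]
  exact mul_mem (loopDiff_valMap_mem_range_Phi hconn _ _)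
    (loopDiff_valMap_mem_range_Phi hconn _ _)

theorem comesFromFreeProd_comp (hU : ∀ x, ∃ j, U j ∈ 𝓝 x)
    (hconn : ∀ i j, IsPathConnected (U i ∩ U j)) :
    (comesFromFreeProd hx).IsStableUnderComposition where
  comp_mem {x y z} w w' hw hw' := by
    intro i j hi hj p q
    obtain ⟨k, hk⟩ := hU y.as
    have hk := mem_of_mem_nhds hk
    obtain ⟨r⟩ := nonempty_homIn (hconn k k) ⟨hx k, hx k⟩ ⟨hk, hk⟩
    let r' : HomIn (U k) (hx k) hk := inclMap inter_subset_left r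
    rw [← loopDiff_mul_loopDiff _ (valMap r' ≫ w'), ← Category.assoc, loopDiff_comp_comp]
    exact mul_mem (hw' k j hk hj r' q) (hw i k hi hk p r')

theorem Phi_surjective (hU : ∀ x, ∃ j, U j ∈ 𝓝 x)
    (hconn : ∀ i j, IsPathConnected (U i ∩ U j)) : Function.Surjective (Phi U x₀ hx) := by
  have := comesFromFreeProd_comp (hx := hx) hU hconn
  intro g
  obtain ⟨j, -⟩ := hU x₀
  have h := morphismProperty_of_local hU (comesFromFreeProd hx)
    (fun _ _ _ _ _ w => comesFromFreeProd_valMap hconn w) g j j (hx j) (hx j) (𝟙 _) (𝟙 _)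
  have valMap_id : valMap (𝟙 (FundamentalGroupoid.mk (⟨x₀, hx j⟩ : U j))) = 𝟙 _ :=
    CategoryTheory.Functor.map_id _ _
  rwa [valMap_id, Category.id_comp, loopDiff_id] at h

end Surjectivity

/-- A parallel transport with values in a group along the paths that stay in one member of the
family `U`, invariant under homotopies that stay in one member of `U`. -/
structure LocalTransport {X J : Type*} [TopologicalSpace X] (U : J → Set X) (G : Type*)
    [Group G] where
  /-- The transport along a path, with an arbitrary value for paths that leave every `U j`. -/
  along {x y : X} : Path x y → G
  along_trans (j : J) {a b c : U j} (p : Path a b) (q : Path b c) :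
    along ((p.trans q).map continuous_subtype_val) =
      along (q.map continuous_subtype_val) * along (p.map continuous_subtype_val)
  along_homotopic (j : J) {a b : U j} {p q : Path a b} : p.Homotopic q →
    along (p.map continuous_subtype_val) = along (q.map continuous_subtype_val)

namespace LocalTransport

variable {X J : Type*} [TopologicalSpace X] {U : J → Set X} {G : Type*} [Group G]
  (T : LocalTransport U G) {x y z : X}

theorem along_congr {x' y' : X} {p : Path x y} {q : Path x' y'} (h : ∀ r, p r = q r) :
    T.along p = T.along q := by
  obtain rfl : x = x' := by simpa using h 0
  obtain rfl : y = y' := by simpa using h 1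
  rw [Path.ext (funext h)]

theorem along_eq_one {j : J} {p : Path x y} {a : X} (ha : a ∈ U j) (h : ∀ r, p r = a) :
    T.along p = 1 := by
  let c : U j := ⟨a, ha⟩
  have idem := T.along_trans j (.refl c) (.refl c)
  rw [Path.refl_trans_refl, right_eq_mul] at idem
  exact (T.along_congr h).trans idem

theorem along_subpath_mul {j : J} (γ : Path x y) {a b c : I} (hab : a ≤ b) (hbc : b ≤ c)
    (h : range (γ.subpath a c) ⊆ U j) :
    T.along (γ.subpath b c) * T.along (γ.subpath a b) = T.along (γ.subpath a c) := by
  obtain ⟨r, rfl⟩ := exists_convexComb_eq hab hbc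
  let δ := restrictPath (A := U j) (γ.subpath a c) (range_subset_iff.1 h)
  have along_δ (s t : I) : T.along ((δ.subpath s t).map continuous_subtype_val) =
      T.along (γ.subpath (Icc.convexComb a c s) (Icc.convexComb a c t)) :=
    T.along_congr (subpath_subpath_apply γ a c s t)
  have homotopic : ((δ.subpath 0 r).trans (δ.subpath r 1)).Homotopic (δ.subpath 0 1) :=
    ⟨Path.Homotopy.subpathTransSubpath δ 0 r 1⟩
  have h := T.along_homotopic j homotopic
  simp only [T.along_trans, along_δ] at h
  rwa [Icc.convexComb_zero, Icc.convexComb_one] at h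

theorem along_map_mul_along_map {Y : Type*} [TopologicalSpace Y] [SimplyConnectedSpace Y]
    {j : J} (f : C(Y, X)) (hf : ∀ y, f y ∈ U j) {a b b' c : Y}
    (p : Path a b) (q : Path b c) (p' : Path a b') (q' : Path b' c) :
    T.along (q.map f.continuous) * T.along (p.map f.continuous) =
      T.along (q'.map f.continuous) * T.along (p'.map f.continuous) := by
  let F : C(Y, U j) := ⟨fun y => ⟨f y, hf y⟩, by fun_prop⟩
  refine (T.along_trans j (p.map F.continuous) (q.map F.continuous)).symm.trans
    (.trans ?_ (T.along_trans j (p'.map F.continuous) (q'.map F.continuous)))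
  rw [← Path.map_trans, ← Path.map_trans]
  exact T.along_homotopic j ((SimplyConnectedSpace.paths_homotopic _ _).map F)

/-- A potential for the transport along `γ` on a set of times: a function that changes by the
transport along every subpath that lies in one member of `U`. -/
def IsPotentialOn (γ : Path x y) (S : Set I) (u : I → G) : Prop :=
  ∀ j, ∀ s ∈ S, ∀ t ∈ S, s ≤ t → range (γ.subpath s t) ⊆ U j →
    u t = T.along (γ.subpath s t) * u s

theorem isPotentialOn_along_subpath {j : J} (γ : Path x y) {a b : I}
    (h : range (γ.subpath a b) ⊆ U j) :
    T.IsPotentialOn γ (Icc a b) fun t => T.along (γ.subpath a t) := fun _ _ hs _ ht hst _ =>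
  (T.along_subpath_mul γ hs.1 hst ((range_subpath_subset γ le_rfl ht.1 ht.2).trans h)).symm

variable {T} in
theorem IsPotentialOn.mul_right {γ : Path x y} {S : Set I} {u : I → G}
    (hu : T.IsPotentialOn γ S u) (g : G) : T.IsPotentialOn γ S fun t => u t * g :=
  fun j s hs t ht hst h => by simp only [hu j s hs t ht hst h, mul_assoc]

variable {T} in
theorem IsPotentialOn.glue {γ : Path x y} {a b c : I} {u v : I → G}
    (hu : T.IsPotentialOn γ (Icc a b) u) (hv : T.IsPotentialOn γ (Icc b c) v) (h : u b = v b) :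
    T.IsPotentialOn γ (Icc a c) fun t => if t ≤ b then u t else v t := by
  intro j s hs t ht hst hU
  rcases le_or_gt t b with htb | hbt
  · simpa [htb, hst.trans htb] using hu j s ⟨hs.1, hst.trans htb⟩ t ⟨ht.1, htb⟩ hst hU
  rcases le_or_gt s b with hsb | hbs
  · have to_b := hu j s ⟨hs.1, hsb⟩ b ⟨hs.1.trans hsb, le_rfl⟩ hsb
      ((range_subpath_subset γ le_rfl hsb hbt.le).trans hU)
    have from_b := hv j b ⟨le_rfl, hbt.le.trans ht.2⟩ t ⟨hbt.le, ht.2⟩ hbt.le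
      ((range_subpath_subset γ hsb hbt.le le_rfl).trans hU)
    simp only [hbt.not_ge, hsb, if_true, if_false]
    rw [from_b, ← h, to_b, ← mul_assoc, T.along_subpath_mul γ hsb hbt.le hU]
  · simpa [hbt.not_ge, hbs.not_ge] using hv j s ⟨hbs.le, hs.2⟩ t ⟨hbt.le, ht.2⟩ hst hU

theorem exists_isPotentialOn (hU : ∀ x, ∃ j, U j ∈ 𝓝 x) (γ : Path x y) :
    ∃ u, T.IsPotentialOn γ (Icc 0 1) u ∧ u 0 = 1 := by
  suffices ∃ u, T.IsPotentialOn γ (Icc 0 1) u by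
    obtain ⟨u, hu⟩ := this
    exact ⟨_, hu.mul_right (u 0)⁻¹, mul_inv_cancel _⟩
  refine unitInterval_induction (P := fun a b => ∃ u, T.IsPotentialOn γ (Icc a b) u)
    (fun t => ?_) ?_
  · obtain ⟨S, hS, j, hj⟩ := exists_mem_nhds_range_subpath_subset hU γ t
    exact ⟨S, hS, fun a b hab h => ⟨_, T.isPotentialOn_along_subpath γ (hj a b hab h)⟩⟩
  · rintro a b c - - ⟨u, hu⟩ ⟨v, hv⟩
    exact ⟨_, hu.glue (hv.mul_right ((v b)⁻¹ * u b)) (by simp)⟩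

variable {T} in
theorem IsPotentialOn.mul_inv_eq (hU : ∀ x, ∃ j, U j ∈ 𝓝 x) {γ : Path x y} {u v : I → G}
    (hu : T.IsPotentialOn γ (Icc 0 1) u) (hv : T.IsPotentialOn γ (Icc 0 1) v) :
    u 1 * (u 0)⁻¹ = v 1 * (v 0)⁻¹ := by
  refine unitInterval_induction (P := fun a b => u b * (u a)⁻¹ = v b * (v a)⁻¹)
    (fun t => ?_) fun a b c _ _ hab hbc => ?_
  · obtain ⟨S, hS, j, hj⟩ := exists_mem_nhds_range_subpath_subset hU γ t
    refine ⟨S, hS, fun a b hab h => ?_⟩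
    have increment {w : I → G} (hw : T.IsPotentialOn γ (Icc 0 1) w) :
        w b * (w a)⁻¹ = T.along (γ.subpath a b) :=
      mul_inv_eq_of_eq_mul (hw j a ⟨nonneg', le_one'⟩ b ⟨nonneg', le_one'⟩ hab (hj a b hab h))
    rw [increment hu, increment hv]
  · simpa using congrArg₂ (· * ·) hbc hab

/-- The transport along an arbitrary path: the total increment of a potential. -/
noncomputable def holonomy (hU : ∀ x, ∃ j, U j ∈ 𝓝 x) (γ : Path x y) : G :=
  (T.exists_isPotentialOn hU γ).choose 1

variable (hU : ∀ x, ∃ j, U j ∈ 𝓝 x)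

variable {T} in
theorem IsPotentialOn.holonomy_eq {γ : Path x y} {u : I → G}
    (hu : T.IsPotentialOn γ (Icc 0 1) u) : T.holonomy hU γ = u 1 * (u 0)⁻¹ := by
  obtain ⟨hv, hv0⟩ := (T.exists_isPotentialOn hU γ).choose_spec
  rw [← hv.mul_inv_eq hU hu, hv0, inv_one, mul_one, holonomy]

theorem holonomy_eq_along {j : J} {γ : Path x y} (h : ∀ t, γ t ∈ U j) :
    T.holonomy hU γ = T.along γ := by
  obtain ⟨u, hu, -⟩ := T.exists_isPotentialOn hU γ
  rw [hu.holonomy_eq hU, hu j 0 ⟨le_rfl, nonneg'⟩ 1 ⟨nonneg', le_rfl⟩ nonneg'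
    (range_subset_iff.2 fun t => h _), mul_inv_cancel_right]
  exact T.along_congr fun r => by simp

theorem holonomy_congr {x' y' : X} {p : Path x y} {q : Path x' y'} (h : ∀ r, p r = q r) :
    T.holonomy hU p = T.holonomy hU q := by
  obtain rfl : x = x' := by simpa using h 0
  obtain rfl : y = y' := by simpa using h 1
  rw [Path.ext (funext h)]

variable {T} in
theorem IsPotentialOn.holonomy_subpath_eq {γ : Path x y} {u : I → G}
    (hu : T.IsPotentialOn γ (Icc 0 1) u) {a b : I} (hab : a ≤ b) :
    T.holonomy hU (γ.subpath a b) = u b * (u a)⁻¹ := by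
  have pullback : T.IsPotentialOn (γ.subpath a b) (Icc 0 1) fun r => u (Icc.convexComb a b r) := by
    intro j s _ t _ hst h
    rw [T.along_congr (subpath_subpath_apply γ a b s t)]
    refine hu j _ ⟨nonneg', le_one'⟩ _ ⟨nonneg', le_one'⟩ (convexComb_le_convexComb hab hst) ?_
    rwa [← funext (subpath_subpath_apply γ a b s t)]
  simpa using pullback.holonomy_eq hU

theorem holonomy_trans (p : Path x y) (q : Path y z) :
    T.holonomy hU (p.trans q) = T.holonomy hU q * T.holonomy hU p := by
  obtain ⟨u, hu, -⟩ := T.exists_isPotentialOn hU (p.trans q)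
  obtain ⟨a, hp, hq⟩ := exists_subpath_trans_apply_eq p q
  rw [← T.holonomy_congr hU hp, ← T.holonomy_congr hU hq, hu.holonomy_eq hU,
    hu.holonomy_subpath_eq hU nonneg', hu.holonomy_subpath_eq hU le_one']
  group

theorem along_homotopy_square {p q : Path x y} (H : p.Homotopy q) {j : J} {s s' t t' : I}
    (hs : s ≤ s') (ht : t ≤ t') (h : Icc s s' ×ˢ Icc t t' ⊆ H ⁻¹' U j) :
    T.along ((H.eval s').subpath t t') * T.along ((H.evalAt t).subpath s s') =
      T.along ((H.evalAt t').subpath s s') * T.along ((H.eval s).subpath t t') := by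
  have : ContractibleSpace I := (convex_Icc (0 : ℝ) 1).contractibleSpace ⟨0, zero_mem⟩
  let K : C(I × I, X) :=
    ⟨fun r => H (Icc.convexComb s s' r.1, Icc.convexComb t t' r.2), by fun_prop⟩
  have hK (r : I × I) : K r ∈ U j :=
    h ⟨⟨Icc.le_convexComb hs _, Icc.convexComb_le hs _⟩,
      ⟨Icc.le_convexComb ht _, Icc.convexComb_le ht _⟩⟩
  have square := T.along_map_mul_along_map K hK (path01.prod (.refl 0)) ((Path.refl 1).prod path01)
    ((Path.refl 0).prod path01) (path01.prod (.refl 1))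
  have eval_apply (s r : I) : H.eval s r = H (s, r) := rfl
  have evalAt_apply (t r : I) : H.evalAt t r = H (r, t) := rfl
  refine (congrArg₂ (· * ·) (T.along_congr fun r => ?_) (T.along_congr fun r => ?_)).trans
    (square.trans (congrArg₂ (· * ·) (T.along_congr fun r => ?_) (T.along_congr fun r => ?_)))
  all_goals simp [K, subpath_apply, eval_apply, evalAt_apply, path01]

theorem holonomy_eval_eq_eval {p q : Path x y} (H : p.Homotopy q) {s s' : I} (hs : s ≤ s')
    {d : ℕ → I} (d_zero : d 0 = 0) (d_mono : Monotone d) {n : ℕ} (d_n : d n = 1)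
    (hd : ∀ m, ∃ j, Icc s s' ×ˢ Icc (d m) (d (m + 1)) ⊆ H ⁻¹' U j) :
    T.holonomy hU (H.eval s) = T.holonomy hU (H.eval s') := by
  obtain ⟨u, hu, hu0⟩ := T.exists_isPotentialOn hU (H.eval s)
  obtain ⟨v, hv, hv0⟩ := T.exists_isPotentialOn hU (H.eval s')
  let side (t : I) : G := T.along ((H.evalAt t).subpath s s')
  have side_zero : side 0 = 1 := by
    obtain ⟨j, hj⟩ := hU x
    exact T.along_eq_one (mem_of_mem_nhds hj) fun r => H.source _
  have side_one : side 1 = 1 := by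
    obtain ⟨j, hj⟩ := hU y
    exact T.along_eq_one (mem_of_mem_nhds hj) fun r => H.target _
  have side_mul (m : ℕ) : side (d m) * u (d m) = v (d m) := by
    induction m with
    | zero => rw [d_zero, side_zero, hu0, hv0, mul_one]
    | succ m ih =>
      obtain ⟨j, hj⟩ := hd m
      have hdm := d_mono m.le_succ
      have hj' (r : I) (hr : r ∈ Icc s s') :
          range ((H.eval r).subpath (d m) (d (m + 1))) ⊆ U j := by
        rw [(H.eval r).range_subpath_of_le _ _ hdm]
        exact image_subset_iff.2 fun t ht => hj ⟨hr, ht⟩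
      have square := T.along_homotopy_square H hs hdm hj
      rw [hu j (d m) ⟨nonneg', le_one'⟩ _ ⟨nonneg', le_one'⟩ hdm (hj' s ⟨le_rfl, hs⟩),
        hv j (d m) ⟨nonneg', le_one'⟩ _ ⟨nonneg', le_one'⟩ hdm (hj' s' ⟨hs, le_rfl⟩), ← ih,
        ← mul_assoc, ← mul_assoc, square]
  have side_mul_n := side_mul n
  rw [d_n, side_one, one_mul] at side_mul_n
  rw [hu.holonomy_eq hU, hv.holonomy_eq hU, hu0, hv0, side_mul_n]

theorem holonomy_eq_of_homotopic {p q : Path x y} (h : p.Homotopic q) :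
    T.holonomy hU p = T.holonomy hU q := by
  obtain ⟨H⟩ := h
  obtain ⟨d, d_zero, d_mono, ⟨n, hn⟩, hd⟩ :=
    exists_monotone_Icc_subset_open_cover_unitInterval_prod_self
      (c := fun j => H ⁻¹' interior (U j)) (fun j => isOpen_interior.preimage H.continuous)
      fun r _ => mem_iUnion.2 ((hU (H r)).imp fun j hj => mem_interior_iff_mem_nhds.2 hj)
  have strip (k : ℕ) : T.holonomy hU (H.eval (d k)) = T.holonomy hU (H.eval (d (k + 1))) :=
    T.holonomy_eval_eq_eval hU H (d_mono k.le_succ) d_zero d_mono (hn n le_rfl) fun m =>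
      (hd k m).imp fun _ h => h.trans (preimage_mono interior_subset)
  have strips (k : ℕ) : T.holonomy hU (H.eval (d 0)) = T.holonomy hU (H.eval (d k)) := by
    induction k with
    | zero => rfl
    | succ k ih => exact ih.trans (strip k)
  simpa [d_zero, hn n le_rfl] using strips n

/-- Parallel transport around loops. -/
noncomputable def monodromy (x : X) : FundamentalGroup X x →* G :=
  .mk' (Quotient.lift (T.holonomy hU) fun _ _ => T.holonomy_eq_of_homotopic hU) fun g h => by
    induction g using Path.Homotopic.Quotient.ind with | mk p =>
    induction h using Path.Homotopic.Quotient.ind with | mk q =>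
    exact T.holonomy_trans hU q p

end LocalTransport

section UniversalProperty

variable {X J : Type*} [TopologicalSpace X] {U : J → Set X} {x₀ : X} {hx : ∀ j, x₀ ∈ U j}
  {G : Type*} [Group G] {f : ∀ j, FundamentalGroup (U j) ⟨x₀, hx j⟩ →* G} {x y : X}

/-- Homomorphisms on the fundamental groups of the members of `U` that agree on the loops in the
pairwise intersections. -/
def Compatible (f : ∀ j, FundamentalGroup (U j) ⟨x₀, hx j⟩ →* G) : Prop :=
  ∀ i j (h : x₀ ∈ U i ∩ U j) (g : FundamentalGroup ↑(U i ∩ U j) ⟨x₀, h⟩),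
    f i (inclHomOfSubset inter_subset_left x₀ h g) =
      f j (inclHomOfSubset inter_subset_right x₀ h g)

/-- An extension of the family `f` from loops at `x₀` to the paths from `x₀` to `x` that lie in one
member of `U`. -/
structure PathExtension (f : ∀ j, FundamentalGroup (U j) ⟨x₀, hx j⟩ →* G) (x : X) where
  /-- The value on a path class in `U i`. -/
  toFun {i : J} {hi : x ∈ U i} : HomIn (U i) (hx i) hi → G
  eq_mul {i : J} {hi : x ∈ U i} (p q : HomIn (U i) (hx i) hi) :
    toFun p = toFun q * f i (loopDiff p q)
  agree {i j : J} {h₀ : x₀ ∈ U i ∩ U j} {h : x ∈ U i ∩ U j} (p : HomIn (U i ∩ U j) h₀ h) :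
    toFun (inclMap inter_subset_left p) = toFun (inclMap inter_subset_right p)

theorem Compatible.map_loopDiff (hf : Compatible f) {i j : J} {h₀ : x₀ ∈ U i ∩ U j}
    {h : x ∈ U i ∩ U j} (p q : HomIn (U i ∩ U j) h₀ h) :
    f i (loopDiff (inclMap inter_subset_left p) (inclMap inter_subset_left q)) =
      f j (loopDiff (inclMap inter_subset_right p) (inclMap inter_subset_right q)) := by
  simpa only [inclHomOfSubset_loopDiff] using hf i j h₀ (loopDiff p q)

theorem map_loopDiff_mul_map_loopDiff {i : J} {hi : x ∈ U i} (p q r : HomIn (U i) (hx i) hi) :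
    f i (loopDiff q r) * f i (loopDiff p q) = f i (loopDiff p r) := by
  rw [← map_mul]
  exact congrArg (f i) (loopDiff_mul_loopDiff p q r)

theorem Compatible.map_loopDiff_mul_eq (hf : Compatible f) {i j : J} {h₀ : x₀ ∈ U i ∩ U j}
    {h : x ∈ U i ∩ U j} {hi : x ∈ U i} {hj : x ∈ U j}
    (m : HomIn (U j) (hx j) hj) (p : HomIn (U i) (hx i) hi)
    (l l' : HomIn (U i ∩ U j) h₀ h) :
    f j (loopDiff (inclMap inter_subset_right l) m) *
        f i (loopDiff p (inclMap inter_subset_left l)) =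
      f j (loopDiff (inclMap inter_subset_right l') m) *
        f i (loopDiff p (inclMap inter_subset_left l')) := by
  rw [← map_loopDiff_mul_map_loopDiff p (inclMap inter_subset_left l'), hf.map_loopDiff l' l,
    ← mul_assoc, map_loopDiff_mul_map_loopDiff]

theorem Compatible.nonempty_pathExtension (hf : Compatible f)
    (hconn : ∀ i j k, IsPathConnected (U i ∩ U j ∩ U k)) {k : J} (hk : x ∈ U k) :
    Nonempty (PathExtension f x) := by
  have connector (i j : J) (hi : x ∈ U i) (hj : x ∈ U j) :=
    nonempty_homIn (hconn i j k) (mem_inter (mem_inter (hx i) (hx j)) (hx k))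
      (mem_inter (mem_inter hi hj) hk)
  obtain ⟨m⟩ := connector k k hk hk
  let m' : HomIn (U k) (hx k) hk := inclMap inter_subset_right m
  let l' (i : J) (hi : x ∈ U i) : HomIn (U i ∩ U k) (mem_inter (hx i) (hx k)) (mem_inter hi hk) :=
    inclMap (inter_subset_inter_left _ inter_subset_left) (connector i i hi hi).some
  -- The value on `p` compares `p` with the fixed path `m'` through a path `l' i` in `U i ∩ U k`. It
  -- does not depend on this path, and a path in the triple intersection serves both `i` and `j`.
  refine ⟨fun {i hi} p => f k (loopDiff (inclMap inter_subset_right (l' i hi)) m') *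
    f i (loopDiff p (inclMap inter_subset_left (l' i hi))), fun p q => ?_, fun {i j h₀ h} p => ?_⟩
  · rw [mul_assoc, map_loopDiff_mul_map_loopDiff]
  · obtain ⟨n⟩ := connector i j h.1 h.2
    let n' : HomIn (U i ∩ U j) h₀ h := inclMap inter_subset_left n
    rw [hf.map_loopDiff_mul_eq m' _ _ (inclMap (inter_subset_inter_left _ inter_subset_left) n),
      hf.map_loopDiff_mul_eq m' _ (l' j h.2)
        (inclMap (inter_subset_inter_left _ inter_subset_right) n)]
    have same_loop := hf.map_loopDiff p n'
    simp only [n', inclMap_inclMap] at same_loop ⊢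
    rw [same_loop]

namespace PathExtension

theorem comp_mul_inv_eq (E : PathExtension f x) (F : PathExtension f y) {i : J} {hxi : x ∈ U i}
    {hyi : y ∈ U i} (w : HomIn (U i) hxi hyi) (p q : HomIn (U i) (hx i) hxi) :
    F.toFun (p ≫ w) * (E.toFun p)⁻¹ = F.toFun (q ≫ w) * (E.toFun q)⁻¹ := by
  rw [F.eq_mul (p ≫ w) (q ≫ w), E.eq_mul p q, loopDiff_comp_comp, mul_inv_rev, ← mul_assoc,
    mul_inv_cancel_right]

theorem comp_inclMap_mul_inv_eq (hconn : ∀ i j, IsPathConnected (U i ∩ U j))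
    (E : PathExtension f x) (F : PathExtension f y) {i j : J} {h : x ∈ U i ∩ U j}
    {h' : y ∈ U i ∩ U j} (w : HomIn (U i ∩ U j) h h')
    {hi : x ∈ U i} {hj : x ∈ U j} (p : HomIn (U i) (hx i) hi) (q : HomIn (U j) (hx j) hj) :
    F.toFun (p ≫ inclMap inter_subset_left w) * (E.toFun p)⁻¹ =
      F.toFun (q ≫ inclMap inter_subset_right w) * (E.toFun q)⁻¹ := by
  obtain ⟨l⟩ := nonempty_homIn (hconn i j) (mem_inter (hx i) (hx j)) h
  rw [comp_mul_inv_eq E F _ p (inclMap inter_subset_left l),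
    comp_mul_inv_eq E F _ q (inclMap inter_subset_right l), ← inclMap_comp, ← inclMap_comp,
    F.agree, E.agree]

theorem exists_increment (hconn : ∀ i j, IsPathConnected (U i ∩ U j))
    (E : PathExtension f x) (F : PathExtension f y) (γ : Path x y) :
    ∃ g : G, ∀ i (h : ∀ t, γ t ∈ U i) (p : HomIn (U i) (hx i) (γ.source ▸ h 0)),
      g = F.toFun (p ≫ .mk (restrictPath γ h)) * (E.toFun p)⁻¹ := by
  by_cases hγ : ∃ j, ∀ t, γ t ∈ U j
  · obtain ⟨j, hj⟩ := hγ
    obtain ⟨l⟩ := nonempty_homIn (hconn j j) ⟨hx j, hx j⟩ ⟨γ.source ▸ hj 0, γ.source ▸ hj 0⟩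
    let q : HomIn (U j) (hx j) (γ.source ▸ hj 0) := inclMap inter_subset_left l
    exact ⟨F.toFun (q ≫ .mk (restrictPath γ hj)) * (E.toFun q)⁻¹, fun i hi p =>
      comp_inclMap_mul_inv_eq hconn E F
        (.mk (restrictPath γ fun t => mem_inter (hj t) (hi t))) q p⟩
  · exact ⟨1, fun i h => (hγ ⟨i, h⟩).elim⟩

theorem toFun_id (E : PathExtension f x₀) (i j : J) :
    E.toFun (𝟙 (FundamentalGroupoid.mk (⟨x₀, hx i⟩ : U i))) =
      E.toFun (𝟙 (FundamentalGroupoid.mk (⟨x₀, hx j⟩ : U j))) :=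
  E.agree (h := ⟨hx i, hx j⟩) (𝟙 (FundamentalGroupoid.mk (⟨x₀, hx i, hx j⟩ : ↑(U i ∩ U j))))

end PathExtension

theorem isPathConnected_inter (hconn : ∀ i j k, IsPathConnected (U i ∩ U j ∩ U k)) (i j : J) :
    IsPathConnected (U i ∩ U j) := by
  simpa only [inter_assoc, inter_self] using hconn i j j

theorem Compatible.exists_localTransport (hf : Compatible f) (hU : ∀ x, ∃ j, x ∈ U j)
    (hconn : ∀ i j k, IsPathConnected (U i ∩ U j ∩ U k)) :
    ∃ (T : LocalTransport U G) (e : G), ∀ j (γ : Path (⟨x₀, hx j⟩ : U j) ⟨x₀, hx j⟩),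
      T.along (γ.map continuous_subtype_val) = e * f j (.mk γ) * e⁻¹ := by
  have hconn₂ := isPathConnected_inter hconn
  let E (x : X) := (hf.nonempty_pathExtension hconn (hU x).choose_spec).some
  choose along h_along using fun (x y : X) => (E x).exists_increment hconn₂ (E y)
  have along_map {j : J} {a b : U j} (γ : Path a b) (p : HomIn (U j) (hx j) a.2) :
      along a b (γ.map continuous_subtype_val) =
        (E b).toFun (p ≫ .mk γ) * ((E a).toFun p)⁻¹ :=
    h_along a b _ j (fun t => (γ t).2) p
  have path_to {j : J} (a : U j) : Nonempty (HomIn (U j) (hx j) a.2) :=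
    nonempty_homIn (by simpa only [inter_self] using hconn₂ j j) _ _
  obtain ⟨k, -⟩ := hU x₀
  refine ⟨⟨along _ _, fun j a b c p q => ?_, fun j a b p q h => ?_⟩,
    (E x₀).toFun (𝟙 (FundamentalGroupoid.mk (⟨x₀, hx k⟩ : U k))), fun j γ => ?_⟩
  · obtain ⟨r⟩ := path_to a
    rw [along_map _ r, along_map p r, along_map q (r ≫ .mk p), Category.assoc, ← mul_assoc,
      inv_mul_cancel_right]
    rfl
  · obtain ⟨r⟩ := path_to a
    rw [along_map p r, along_map q r, Path.Homotopic.Quotient.eq.2 h]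
  · refine (along_map γ (𝟙 _)).trans ?_
    rw [Category.id_comp, (E x₀).eq_mul _ (𝟙 _), loopDiff_id,
      (E x₀).toFun_id j k]

theorem Compatible.exists_lift (hf : Compatible f) (hU : ∀ x, ∃ j, U j ∈ 𝓝 x)
    (hconn : ∀ i j k, IsPathConnected (U i ∩ U j ∩ U k)) :
    ∃ Ψ : FundamentalGroup X x₀ →* G, ∀ j, Ψ.comp (inclHom (U j) x₀ (hx j)) = f j := by
  obtain ⟨T, e, hT⟩ := hf.exists_localTransport
    (fun x => (hU x).imp fun _ => mem_of_mem_nhds) hconn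
  refine ⟨(MulAut.conj e⁻¹).toMonoidHom.comp (T.monodromy hU x₀), fun j => ?_⟩
  ext g
  induction g using Path.Homotopic.Quotient.ind with | mk γ =>
  have monodromy_incl : T.monodromy hU x₀ (inclHom (U j) x₀ (hx j) (.mk γ)) =
      e * f j (.mk γ) * e⁻¹ :=
    (T.holonomy_eq_along hU fun t => (γ t).2).trans (hT j γ)
  simp [monodromy_incl, mul_assoc]

end UniversalProperty

section Kernel

variable {X J : Type*} [TopologicalSpace X] {U : J → Set X} {x₀ : X} {hx : ∀ j, x₀ ∈ U j}

theorem inclHom_inclHomOfSubset {A B : Set X} (h : A ⊆ B) {hA : x₀ ∈ A}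
    (g : FundamentalGroup A ⟨x₀, hA⟩) :
    inclHom B x₀ (h hA) (inclHomOfSubset h x₀ hA g) = inclHom A x₀ hA g :=
  valMap_inclMap h g

theorem N_le_ker_Phi : N U x₀ hx ≤ (Phi U x₀ hx).ker := by
  refine Subgroup.normalClosure_le_normal ?_
  rintro _ ⟨i, j, g, rfl⟩
  have Phi_toFreeProd (k : J) (h) :
      Phi U x₀ hx (toFreeProd U x₀ hx k h) = inclHom (U k) x₀ (hx k) h :=
    Monoid.CoprodI.lift_of _ _
  rw [SetLike.mem_coe, MonoidHom.mem_ker, map_mul, map_inv, Phi_toFreeProd, Phi_toFreeProd,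
    mul_inv_eq_one]
  exact (inclHom_inclHomOfSubset inter_subset_left g).trans
    (inclHom_inclHomOfSubset inter_subset_right g).symm

instance : (N U x₀ hx).Normal :=
  Subgroup.normalClosure_normal

variable (U hx) in
theorem compatible_mk'_comp_toFreeProd :
    Compatible fun j => (QuotientGroup.mk' (N U x₀ hx)).comp (toFreeProd U x₀ hx j) := by
  intro i j _ g
  refine (QuotientGroup.eq_iff_div_mem).2 ?_
  rw [div_eq_mul_inv]
  exact Subgroup.subset_normalClosure ⟨i, j, g, rfl⟩

theorem ker_Phi_le_N (hU : ∀ x, ∃ j, U j ∈ 𝓝 x)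
    (hconn : ∀ i j k, IsPathConnected (U i ∩ U j ∩ U k)) :
    (Phi U x₀ hx).ker ≤ N U x₀ hx := by
  obtain ⟨Ψ, hΨ⟩ := (compatible_mk'_comp_toFreeProd U hx).exists_lift hU hconn
  have Ψ_comp_Phi : Ψ.comp (Phi U x₀ hx) = QuotientGroup.mk' (N U x₀ hx) :=
    Monoid.CoprodI.ext_hom _ _ fun j => by
      rw [MonoidHom.comp_assoc]
      exact hΨ j
  intro w hw
  rw [← QuotientGroup.ker_mk' (N U x₀ hx), ← Ψ_comp_Phi, MonoidHom.mem_ker, MonoidHom.comp_apply,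
    hw, map_one]

end Kernel

end VanKampen

theorem mainTheorem2_general {X J : Type*} [TopologicalSpace X] (U : J → Set X) (x₀ : X)
    (hU : ∀ x, ∃ j, U j ∈ 𝓝 x) (hx : ∀ j, x₀ ∈ U j) :
    ((∀ i j, IsPathConnected (U i ∩ U j)) →
      Function.Surjective (VanKampen.Phi U x₀ hx)) ∧
    ((∀ i j k, IsPathConnected (U i ∩ U j ∩ U k)) →
      (VanKampen.Phi U x₀ hx).ker = VanKampen.N U x₀ hx) :=
  ⟨VanKampen.Phi_surjective hU,
    fun hconn => (VanKampen.ker_Phi_le_N hU hconn).antisymm VanKampen.N_le_ker_Phi⟩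

theorem mainTheorem2 {X J : Type*} [TopologicalSpace X] (U : J → Set X) (x₀ : X)
    (hopen : ∀ j, IsOpen (U j)) (hconn : ∀ j, IsPathConnected (U j))
    (hcover : ⋃ j, U j = Set.univ) (hx : ∀ j, x₀ ∈ U j) :
    ((∀ i j, IsPathConnected (U i ∩ U j)) →
      Function.Surjective (VanKampen.Phi U x₀ hx)) ∧
    ((∀ i j k, IsPathConnected (U i ∩ U j ∩ U k)) →
      (VanKampen.Phi U x₀ hx).ker = VanKampen.N U x₀ hx) :=
  mainTheorem2_general U x₀
    (fun x => (iUnion_eq_univ_iff.1 hcover x).imp fun j => (hopen j).mem_nhds) hx
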